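/- Let $a<b$ be real numbers and let $g:\mathbb R\to\mathbb R$ be left-continuous and of bounded variation on every compact interval, with $g(a)=0$. Let $\widetilde g$ be its variation function, $\widetilde g(t)=g(0)+\operatorname{var}_g[0,t]$ for $t\ge 0$ and $\widetilde g(t)=g(0)-\operatorname{var}_g[t,0]$ for $t<0$. Let $D_g=\{t\in\mathbb R:\widetilde g(t^+)-\widetilde g(t)>0\}$, let $C_g$ be the open set of points $t$ such that $\widetilde g$ is constant on $(t-\varepsilon,t+\varepsilon)$ for some $\varepsilon>0$, write $C_g=\bigcup_n(a_n,b_n)$ as the disjoint union of its connected components, and let $N_g^-$ be the set of the finite $a_n$ not in $D_g$, $N_g^+$ the set of the finite $b_n$ not in $D_g$, and $N_g=N_g^-\cup N_g^+$. Assume that $a\notin N_g^-$ and $b\notin C_g\cup N_g^+\cup D_g$. For $t\in[a,b]$ put $t^*=t$ if $t\notin C_g$ and $t^*=b_n$ if $t\in(a_n,b_n)\subset C_g$. A function $F:[a,b]\to\mathbb R$ is called $g$-differentiable at $t\in[a,b]$ with Stieltjes derivative $F'_g(t)=d\in\mathbb R$ if there is a function $h:[a,b]\to\mathbb R$ with $h(t^*)=0$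 such that $h$ is continuous at $t^*$ if $t^*\notin C_g\cup D_g\cup N_g$, right-continuous at $t^*$ if $t^*\in D_g\cup N_g^+$, left-continuous at $t^*$ if $t^*\in N_g^-$, and $$F(s)=F(t^*)+[d+h(s)]\,[g(s)-g(t^*)]\quad\text{for all } s\in[a,b]\text{ with } g(s)\neq g(t^*).$$ Let $\mu_g$ be the finite signed Borel measure on $[a,b]$ with $\mu_g([a,t))=g(t)-g(a)$ for all $t\in[a,b]$ and $\mu_g(\{b\})=0$, and let $|\mu_g|$ be its total variation. Let $f:[a,b]\to\mathbb R$ be integrable on $[a,b)$ with respect to $|\mu_g|$, and set $F(t)=\int_{[a,t)}f\,d\mu_g$ for $t\in[a,b]$. Then for $|\mu_g|$-almost every $t\in[a,b]$ the function $F$ is $g$-differentiable at $t$ and $F'_g(t)=f(t)$. -/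

import Mathlib

open Set MeasureTheory

noncomputable section

namespace Stieltjes

/-! Sets attached to a nondecreasing left-continuous derivator `h`. -/

/-- `D_h`: the points where the right jump `h(t⁺) - h(t)` is positive. -/
def jumpSet (h : ℝ → ℝ) : Set ℝ :=
  {t | 0 < Function.rightLim h t - h t}

/-- `C_h`: the points around which `h` is constant. -/
def constSet (h : ℝ → ℝ) : Set ℝ :=
  {t | ∃ ε > 0, ∀ s ∈ Ioo (t - ε) (t + ε), h s = h t}

/-- `N_h⁻`: the (finite) left endpoints of the connected components of `C_h`, except those
in `D_h`. -/
def leftEnds (h : ℝ → ℝ) : Set ℝ :=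
  {x | ∃ t ∈ constSet h, IsGLB (connectedComponentIn (constSet h) t) x} \ jumpSet h

/-- `N_h⁺`: the (finite) right endpoints of the connected components of `C_h`, except those
in `D_h`. -/
def rightEnds (h : ℝ → ℝ) : Set ℝ :=
  {x | ∃ t ∈ constSet h, IsLUB (connectedComponentIn (constSet h) t) x} \ jumpSet h

/-- The variation function of `g`: `g(0) + var_g[0,t]` for `t ≥ 0`, and
`g(0) - var_g[t,0]` for `t < 0`. -/
def varFun (g : ℝ → ℝ) (t : ℝ) : ℝ :=
  g 0 + variationOnFromTo g univ 0 t

/-- `D_g`, for a derivator `g` of locally bounded variation. -/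
def D (g : ℝ → ℝ) : Set ℝ := jumpSet (varFun g)

/-- `C_g`. -/
def C (g : ℝ → ℝ) : Set ℝ := constSet (varFun g)

/-- `N_g⁻`. -/
def Nminus (g : ℝ → ℝ) : Set ℝ := leftEnds (varFun g)

/-- `N_g⁺`. -/
def Nplus (g : ℝ → ℝ) : Set ℝ := rightEnds (varFun g)

/-- `N_g`. -/
def N (g : ℝ → ℝ) : Set ℝ := Nplus g ∪ Nminus g

open Classical in
/-- `t*`: equal to `t` if `t ∉ C_g`, and to the right endpoint of the connected component of `C_g`
that contains `t` otherwise. -/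
def star (g : ℝ → ℝ) (t : ℝ) : ℝ :=
  if t ∈ C g then sSup (connectedComponentIn (C g) t) else t

/-- The function `F : [a,b] → ℝ` is `g`-differentiable at `t`, with Stieltjes derivative
`F'_g(t) = d`. Only the values of `F` and of `h` on `[a,b]` matter. -/
def HasDerivAt (g : ℝ → ℝ) (a b : ℝ) (F : ℝ → ℝ) (d t : ℝ) : Prop :=
  ∃ h : ℝ → ℝ,
    h (star g t) = 0 ∧
    (star g t ∈ Icc a b \ (C g ∪ D g ∪ N g) →
      ContinuousWithinAt h (Icc a b) (star g t)) ∧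
    (star g t ∈ Icc a b ∩ (D g ∪ Nplus g) →
      ContinuousWithinAt h (Icc a b ∩ Ici (star g t)) (star g t)) ∧
    (star g t ∈ Icc a b ∩ Nminus g →
      ContinuousWithinAt h (Icc a b ∩ Iic (star g t)) (star g t)) ∧
    ∀ s ∈ Icc a b, g s ≠ g (star g t) →
      F s = F (star g t) + (d + h s) * (g s - g (star g t))

/-- The restriction of `g` to `[a,b]`, extended to `ℝ` by its values at the endpoints. -/
def clamp (g : ℝ → ℝ) (a b : ℝ) (x : ℝ) : ℝ := g (max a (min b x))

theorem boundedVariationOn_clamp {g : ℝ → ℝ} (hg : LocallyBoundedVariationOn g univ) (a b : ℝ) :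
    BoundedVariationOn (clamp g a b) univ := by
  have hm : Monotone fun x : ℝ => max a (min b x) := fun x y hxy => by
    dsimp only
    gcongr
  have h := eVariationOn.comp_le_of_monotoneOn g (s := univ ∩ Icc a (max a b)) (t := univ)
    (fun x => max a (min b x)) (hm.monotoneOn _)
    (fun x _ => ⟨mem_univ _, le_max_left _ _, max_le_max le_rfl (min_le_left _ _)⟩)
  exact ne_top_of_le_ne_top (hg a (max a b) (mem_univ _) (mem_univ _)) h

/-- The signed Lebesgue--Stieltjes measure `μ_g` on `[a,b]` (as a signed measure on `ℝ` that does
not charge the complement of `[a,b]`). For left-continuous `g` it is given by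
`μ_g([a,t)) = g(t) - g(a)` for `t ∈ [a,b]`, see `measure_Ico`. -/
def measure (g : ℝ → ℝ) (hg : LocallyBoundedVariationOn g univ) (a b : ℝ) : SignedMeasure ℝ :=
  (boundedVariationOn_clamp hg a b).vectorMeasure

theorem continuousWithinAt_clamp {g : ℝ → ℝ} (hc : ∀ t, ContinuousWithinAt g (Iic t) t)
    (a b t : ℝ) : ContinuousWithinAt (clamp g a b) (Iic t) t := by
  have hcont : Continuous fun x : ℝ => max a (min b x) := by fun_prop
  refine ContinuousWithinAt.comp (t := Iic (max a (min b t))) (hc _)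
    hcont.continuousWithinAt fun x (hx : x ≤ t) => ?_
  exact max_le_max le_rfl (min_le_min le_rfl hx)

theorem measure_Ico {g : ℝ → ℝ} (hg : LocallyBoundedVariationOn g univ)
    (hc : ∀ t, ContinuousWithinAt g (Iic t) t) {a b t : ℝ} (ht : t ∈ Icc a b) :
    measure g hg a b (Ico a t) = g t - g a := by
  have hl (x : ℝ) : Function.leftLim (clamp g a b) x = clamp g a b x := by
    have h1 := (continuousWithinAt_clamp hc a b x).mono Iio_subset_Iic_self
    exact leftLim_eq_of_tendsto h1
  rw [measure, BoundedVariationOn.vectorMeasure_Ico _ ht.1, hl, hl]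
  simp [clamp, ht.1, ht.2, ht.1.trans ht.2]

/-- `L¹_g([a,b), ℝ)`: integrability on `[a,b)` with respect to the total variation `|μ_g|`. -/
def MemL1 (g : ℝ → ℝ) (hg : LocallyBoundedVariationOn g univ) (a b : ℝ) (f : ℝ → ℝ) : Prop :=
  IntegrableOn f (Ico a b) (measure g hg a b).totalVariation

/-- `F(t) = ∫_{[a,t)} f dμ_g`. -/
def primitive (g : ℝ → ℝ) (hg : LocallyBoundedVariationOn g univ) (a b : ℝ) (f : ℝ → ℝ)
    (t : ℝ) : ℝ :=
  ∫ᵛ x in Ico a t, f x ∂<•(measure g hg a b)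

end Stieltjes

end

/-! Let `ν = |μ_g|` and `V s = ν (Iio s)`. The polar decomposition `μ_g = σ ν`, `|σ| = 1`, turns the
increments of `g` and `F` on `[a,b]` into `ν`-integrals of `σ` and `f σ`. Pulling `ν` back to
Lebesgue measure by its quantile function, such integrals over `Iio s` become `Φ (V s)` and `Ψ (V
s)`, and Lebesgue differentiation gives `Φ' = σ t`, `Ψ' = f t * σ t` at `V t` for `ν`-almost every
non-atom `t` (`exists_hasDerivAt_setIntegral_Iio`). As `σ t ≠ 0`, the quotient of increments tends
to `f t` (`tendsto_ratio_sub`). At an atom both increments have right limits, `ν {t} * σ t` and `ν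
{t} * f t * σ t`, again with quotient `f t`; there `t ∈ D g`, so right-continuity is enough. Almost
every non-atom lies in the support of `ν`, hence outside `C g`, so `t* = t` in both cases. -/

namespace Stieltjes

open Filter Topology

/-! ### Distribution functions and their one-sided limits. -/

/-- The integral over `Iio s` has the integral over `Iic t` as right limit at `t`. -/
theorem tendsto_setIntegral_Iio_nhdsGT {ν : Measure ℝ} {k : ℝ → ℝ} (hk : Integrable k ν) (t : ℝ) :
    Tendsto (fun s => ∫ x in Iio s, k x ∂ν) (𝓝[>] t) (𝓝 (∫ x in Iic t, k x ∂ν)) := by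
  simp_rw [← integral_indicator measurableSet_Iio, ← integral_indicator measurableSet_Iic]
  refine tendsto_integral_filter_of_dominated_convergence (fun x => ‖k x‖)
    (.of_forall fun s => hk.aestronglyMeasurable.indicator measurableSet_Iio)
    (.of_forall fun s => .of_forall fun x => norm_indicator_le_norm_self _ _) hk.norm
    (.of_forall fun x => tendsto_const_nhds.congr' ?_)
  rcases le_or_gt x t with hx | hx
  · filter_upwards [self_mem_nhdsWithin] with s hs
    rw [indicator_of_mem (show x ∈ Iic t from hx),
      indicator_of_mem (show x ∈ Iio s from hx.trans_lt hs)]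
  · filter_upwards [Ioo_mem_nhdsGT hx] with s hs
    rw [indicator_of_notMem (show x ∉ Iic t from hx.not_ge),
      indicator_of_notMem (show x ∉ Iio s from hs.2.not_gt)]

/-- The integral over `Iio s` is left-continuous in `s`. -/
theorem tendsto_setIntegral_Iio_nhdsLT {ν : Measure ℝ} {k : ℝ → ℝ} (hk : Integrable k ν) (t : ℝ) :
    Tendsto (fun s => ∫ x in Iio s, k x ∂ν) (𝓝[<] t) (𝓝 (∫ x in Iio t, k x ∂ν)) := by
  simp_rw [← integral_indicator measurableSet_Iio]
  refine tendsto_integral_filter_of_dominated_convergence (fun x => ‖k x‖)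
    (.of_forall fun s => hk.aestronglyMeasurable.indicator measurableSet_Iio)
    (.of_forall fun s => .of_forall fun x => norm_indicator_le_norm_self _ _) hk.norm
    (.of_forall fun x => tendsto_const_nhds.congr' ?_)
  rcases lt_or_ge x t with hx | hx
  · filter_upwards [Ioo_mem_nhdsLT hx] with s hs
    rw [indicator_of_mem (show x ∈ Iio t from hx), indicator_of_mem (show x ∈ Iio s from hs.1)]
  · filter_upwards [self_mem_nhdsWithin] with s (hs : s < t)
    rw [indicator_of_notMem (show x ∉ Iio t from hx.not_gt),
      indicator_of_notMem (show x ∉ Iio s from (hs.trans_le hx).not_gt)]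

section FiniteMeasure

variable (ν : Measure ℝ) [IsFiniteMeasure ν]

theorem monotone_measureReal_Iio : Monotone fun s => ν.real (Iio s) :=
  fun _ _ h => measureReal_mono (Iio_subset_Iio h)

theorem tendsto_measureReal_Iio_nhdsLT (t : ℝ) :
    Tendsto (fun s => ν.real (Iio s)) (𝓝[<] t) (𝓝 (ν.real (Iio t))) := by
  simpa using tendsto_setIntegral_Iio_nhdsLT (integrable_const (μ := ν) (1 : ℝ)) t

theorem tendsto_measureReal_Iio_nhdsGT (t : ℝ) :
    Tendsto (fun s => ν.real (Iio s)) (𝓝[>] t) (𝓝 (ν.real (Iic t))) := by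
  simpa using tendsto_setIntegral_Iio_nhdsGT (integrable_const (μ := ν) (1 : ℝ)) t

variable {ν}

theorem measureReal_Iic_eq_Iio {t : ℝ} (ht : ν {t} = 0) : ν.real (Iic t) = ν.real (Iio t) := by
  rw [← Iio_union_right, measureReal_union (by simp) (measurableSet_singleton t),
    measureReal_def ν {t}, ht]
  simp

theorem continuousAt_measureReal_Iio {t : ℝ} (ht : ν {t} = 0) :
    ContinuousAt (fun s => ν.real (Iio s)) t := by
  refine continuousAt_iff_continuous_left'_right'.2 ⟨tendsto_measureReal_Iio_nhdsLT ν t, ?_⟩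
  have := tendsto_measureReal_Iio_nhdsGT ν t
  rwa [measureReal_Iic_eq_Iio ht] at this

/-! ### Quantile transform and Lebesgue differentiation. -/

variable (ν)

/-- The quantile function of a finite measure on `ℝ`. -/
theorem exists_measurable_quantile :
    ∃ P : ℝ → ℝ, Measurable P ∧
      ∀ y ∈ Ioo 0 (ν.real univ), ∀ t, P y < t ↔ y < ν.real (Iio t) := by
  have hmono := monotone_measureReal_Iio ν
  have key : ∀ y ∈ Ioo 0 (ν.real univ), ∀ t,
      sSup {x | ν.real (Iio x) ≤ y} < t ↔ y < ν.real (Iio t) := by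
    intro y hy t
    -- `0 < y` makes the set nonempty, and `y < ν.real univ` bounds it above.
    have hne : {x | ν.real (Iio x) ≤ y}.Nonempty := by
      have h := (ENNReal.tendsto_toReal (measure_ne_top ν univ)).comp
        (tendsto_measure_Ici_atBot ν)
      obtain ⟨x, hx⟩ := (h.eventually (Ioi_mem_nhds (sub_lt_self (ν.real univ) hy.1))).exists
      refine ⟨x, ?_⟩
      have hc : ν.real (Ici x) = ν.real univ - ν.real (Iio x) := by
        rw [← measureReal_compl measurableSet_Iio, compl_Iio]
      change ν.real univ - y < ν.real (Ici x) at hx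
      exact (by linarith : ν.real (Iio x) ≤ y)
    have hbdd : BddAbove {x | ν.real (Iio x) ≤ y} := by
      have h := (ENNReal.tendsto_toReal (measure_ne_top ν univ)).comp
        (tendsto_measure_Iic_atTop ν)
      obtain ⟨u, hu⟩ := (h.eventually (Ioi_mem_nhds hy.2)).exists
      refine ⟨u, fun x hx => ?_⟩
      by_contra! hxu
      exact absurd (measureReal_mono (Iic_subset_Iio.2 hxu)) (not_le.2 (lt_of_le_of_lt hx hu))
    constructor
    · intro h
      by_contra! h'
      exact absurd (le_csSup hbdd h') h.not_ge
    · intro h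
      -- Left-continuity of the distribution function is what makes the inequality `< t` strict.
      obtain ⟨u, hut, hu⟩ := ((tendsto_measureReal_Iio_nhdsLT ν t).eventually
        (Ioi_mem_nhds h)).and self_mem_nhdsWithin |>.exists
      refine lt_of_le_of_lt (csSup_le hne fun x hx => ?_) hu
      by_contra! hxu
      exact absurd (hmono hxu.le) (not_le.2 (lt_of_le_of_lt hx hut))
  classical
  refine ⟨(Ioo 0 (ν.real univ)).piecewise (fun y => sSup {x | ν.real (Iio x) ≤ y}) 0, ?_, ?_⟩
  · refine measurable_of_Iio fun t => ?_
    rw [piecewise_preimage, Set.ite]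
    refine MeasurableSet.union ?_ ((measurable_const measurableSet_Iio).diff measurableSet_Ioo)
    have : (fun y => sSup {x | ν.real (Iio x) ≤ y}) ⁻¹' Iio t ∩ Ioo 0 (ν.real univ)
        = Iio (ν.real (Iio t)) ∩ Ioo 0 (ν.real univ) := by
      ext y
      simp only [mem_inter_iff, mem_preimage, mem_Iio, and_congr_left_iff]
      exact fun hy => key y hy t
    rw [this]
    measurability
  · intro y hy t
    rw [piecewise_eq_of_mem _ _ _ hy, key y hy t]

variable {ν}

/-- The quantile function pushes Lebesgue measure forward to the measure. -/
theorem map_quantile_volume {P : ℝ → ℝ} (hPm : Measurable P)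
    (hP : ∀ y ∈ Ioo 0 (ν.real univ), ∀ t, P y < t ↔ y < ν.real (Iio t)) :
    (volume.restrict (Ioo 0 (ν.real univ))).map P = ν := by
  refine Measure.ext_of_Ici _ _ fun t => ?_
  have hpre : P ⁻¹' Ici t ∩ Ioo 0 (ν.real univ) =
      Ici (ν.real (Iio t)) ∩ Ioo 0 (ν.real univ) := by
    ext y
    simp only [mem_inter_iff, mem_preimage, mem_Ici, and_congr_left_iff]
    intro hy
    rw [← not_lt, hP y hy t, not_lt]
  have hν : ENNReal.ofReal (ν.real univ - ν.real (Iio t)) = ν (Ici t) := by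
    rw [← measureReal_compl measurableSet_Iio, compl_Iio, measureReal_def,
      ENNReal.ofReal_toReal (measure_ne_top _ _)]
  rw [Measure.map_apply hPm measurableSet_Ici,
    Measure.restrict_apply (hPm measurableSet_Ici), hpre, ← hν]
  refine le_antisymm ?_ ?_
  · rw [← Real.volume_Icc]
    exact measure_mono fun y hy => ⟨hy.1, hy.2.2.le⟩
  · rw [← Real.volume_Ioo]
    exact measure_mono fun y hy => ⟨hy.1.le, measureReal_nonneg.trans_lt hy.1, hy.2⟩

/-- Differentiation of an integral with respect to a finite measure on `ℝ`, along the distribution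
function of the measure. -/
theorem exists_hasDerivAt_setIntegral_Iio {k : ℝ → ℝ} (hk : Integrable k ν) :
    ∃ Φ : ℝ → ℝ, (∀ s, ∫ x in Iio s, k x ∂ν = Φ (ν.real (Iio s))) ∧
      ∀ᵐ t ∂ν, ν {t} = 0 → _root_.HasDerivAt Φ (k t) (ν.real (Iio t)) := by
  obtain ⟨P, hPm, hP⟩ := exists_measurable_quantile ν
  have hmap := map_quantile_volume hPm hP
  set M := ν.real univ
  have hkP : IntegrableOn (k ∘ P) (Ioo 0 M) := by
    rw [← hmap] at hk
    exact hk.comp_measurable hPm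
  set φ : ℝ → ℝ := (Ioo 0 M).indicator (k ∘ P)
  have hφ : Integrable φ := hkP.integrable_indicator measurableSet_Ioo
  refine ⟨fun z => ∫ y in (0 : ℝ)..z, φ y, fun s => ?_, ?_⟩
  · have hpre : P ⁻¹' Iio s ∩ Ioo 0 M = Ioo 0 (ν.real (Iio s)) := by
      ext y
      simp only [mem_inter_iff, mem_preimage, mem_Iio]
      constructor
      · rintro ⟨h, hy⟩
        exact ⟨hy.1, (hP y hy s).1 h⟩
      · intro hy
        have hyM : y ∈ Ioo 0 M := ⟨hy.1, hy.2.trans_le (measureReal_mono (subset_univ _))⟩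
        exact ⟨(hP y hyM s).2 hy.2, hyM⟩
    have hk' : AEStronglyMeasurable k ((volume.restrict (Ioo 0 M)).map P) :=
      hmap ▸ hk.aestronglyMeasurable
    conv_lhs => rw [← hmap]
    rw [setIntegral_map measurableSet_Iio hk' hPm.aemeasurable,
      Measure.restrict_restrict (hPm measurableSet_Iio), hpre]
    dsimp only
    rw [intervalIntegral.integral_of_le measureReal_nonneg, integral_Ioc_eq_integral_Ioo]
    refine setIntegral_congr_fun measurableSet_Ioo fun y hy => ?_
    rw [← hpre] at hy
    exact (indicator_of_mem hy.2 (k ∘ P)).symm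
  · set Φ : ℝ → ℝ := fun z => ∫ y in (0 : ℝ)..z, φ y
    have hae : ∀ᵐ y, _root_.HasDerivAt Φ (φ y) y := by
      filter_upwards [LocallyIntegrable.ae_hasDerivAt_integral hφ.locallyIntegrable] with y hy
      exact hy 0
    -- A measurable exceptional set, so that the almost-everywhere statement can be transported
    -- along `P`.
    obtain ⟨T, hTsub, hTm, hT⟩ :=
      exists_measurable_superset_of_null (ae_iff.1 hae)
    have hV : Measurable fun s => ν.real (Iio s) := (monotone_measureReal_Iio ν).measurable
    have hatoms : MeasurableSet {t | ν {t} = 0} := by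
      have := (Measure.countable_meas_pos_of_disjoint_iUnion (μ := ν)
        (As := fun t : ℝ => {t}) (fun t => measurableSet_singleton t)
        (fun s t h => by simpa [Function.onFun] using h)).measurableSet.compl
      convert this using 1
      ext t
      simp
    have hgood : ∀ᵐ t ∂(volume.restrict (Ioo 0 M)).map P, ν {t} = 0 →
        (ν.real (Iio t) ∈ Tᶜ ∩ Ioo 0 M ∧ P (ν.real (Iio t)) = t) := by
      rw [ae_map_iff hPm.aemeasurable]
      · have hT' : ∀ᵐ y ∂volume.restrict (Ioo 0 M), y ∉ T :=
          ae_restrict_of_ae (measure_eq_zero_iff_ae_notMem.1 hT)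
        filter_upwards [hT', ae_restrict_mem measurableSet_Ioo] with y hyT hy ht
        -- In general `ν (Iio (P y)) ≤ y ≤ ν (Iic (P y))`; the two ends agree when `P y` is not an
        -- atom.
        have hVy : ν.real (Iio (P y)) = y := by
          refine le_antisymm (not_lt.1 fun h => lt_irrefl _ ((hP y hy _).2 h)) ?_
          rw [← measureReal_Iic_eq_Iio ht]
          refine ge_of_tendsto (tendsto_measureReal_Iio_nhdsGT ν (P y)) ?_
          filter_upwards [self_mem_nhdsWithin] with s hs
          exact ((hP y hy s).1 hs).le
        rw [hVy]
        exact ⟨⟨hyT, hy⟩, rfl⟩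
      · refine MeasurableSet.imp hatoms (MeasurableSet.inter ?_ ?_)
        · exact hV (hTm.compl.inter measurableSet_Ioo)
        · exact measurableSet_eq_fun (hPm.comp hV) measurable_id
    rw [hmap] at hgood
    filter_upwards [hgood] with t ht h0
    obtain ⟨⟨hnT, hM⟩, hPt⟩ := ht h0
    have hd : _root_.HasDerivAt Φ (φ (ν.real (Iio t))) (ν.real (Iio t)) := by
      by_contra h
      exact hnT (hTsub h)
    have hφt : φ (ν.real (Iio t)) = k t := by
      rw [show φ = (Ioo 0 M).indicator (k ∘ P) from rfl, indicator_of_mem hM, Function.comp, hPt]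
    rwa [hφt] at hd

end FiniteMeasure

/-! ### Sign density of a signed measure and quotients of increments. -/

/-- Polar decomposition of a signed measure: it has a density with values `±1` with respect to its
total variation. -/
theorem exists_sign_density {X : Type*} [MeasurableSpace X] (μ : SignedMeasure X) :
    ∃ σ : X → ℝ, Measurable σ ∧ (∀ x, |σ x| = 1) ∧
      ∀ I, MeasurableSet I → ∀ f : X → ℝ, IntegrableOn f I μ.totalVariation →
        ∫ᵛ x in I, f x ∂<•μ = ∫ x in I, f x * σ x ∂μ.totalVariation := by
  classical
  obtain ⟨S, hS, -, -, hpos, hneg⟩ := μ.toJordanDecomposition.exists_compl_positive_negative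
  set p := μ.toJordanDecomposition.posPart with hp
  set n := μ.toJordanDecomposition.negPart with hn
  have htv : μ.totalVariation = p + n := rfl
  set σ : X → ℝ := S.piecewise (fun _ => -1) (fun _ => 1) with hσ
  refine ⟨σ, measurable_const.piecewise hS measurable_const, fun x => ?_, fun I hI f hf => ?_⟩
  · by_cases hx : x ∈ S <;> simp [hσ, hx]
  rw [htv, IntegrableOn, Measure.restrict_add, integrable_add_measure] at hf
  have hrestr : μ.restrict I =
      (p.restrict I).toSignedMeasure - (n.restrict I).toSignedMeasure := by
    ext A hA
    rw [VectorMeasure.restrict_apply _ hI hA, μ.apply_eq_posPart_real_sub_negPart_real (hA.inter hI),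
      Measure.toSignedMeasure_sub_apply hA, measureReal_restrict_apply hA,
      measureReal_restrict_apply hA]
  have hσp : ∀ᵐ x ∂p.restrict I, f x = f x * σ x := by
    refine ae_restrict_of_ae ?_
    filter_upwards [measure_eq_zero_iff_ae_notMem.1 hpos] with x hx
    simp [hσ, hx]
  have hσn : ∀ᵐ x ∂n.restrict I, -f x = f x * σ x := by
    refine ae_restrict_of_ae ?_
    filter_upwards [measure_eq_zero_iff_ae_notMem.1 hneg] with x hx
    simp [hσ, not_notMem.1 hx]
  rw [hrestr, VectorMeasure.integral_sub_vectorMeasure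
    (by simpa [VectorMeasure.Integrable] using hf.1)
    (by simpa [VectorMeasure.Integrable] using hf.2),
    VectorMeasure.integral_toSignedMeasure, VectorMeasure.integral_toSignedMeasure, htv,
    Measure.restrict_add, integral_add_measure (hf.1.congr hσp) (hf.2.neg.congr hσn),
    integral_congr_ae hσp, ← integral_congr_ae hσn, integral_neg, sub_eq_add_neg]

/-- The ratio of the increments of two functions, minus the ratio of their derivatives, tends to
`0`; its value is taken to be `0` where the denominator vanishes. -/
theorem tendsto_ratio_sub {Φ Ψ : ℝ → ℝ} {y σ d : ℝ} (hΦ : _root_.HasDerivAt Φ σ y)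
    (hΨ : _root_.HasDerivAt Ψ (d * σ) y) (hσ : σ ≠ 0) :
    Tendsto (fun z => if Φ z = Φ y then 0 else (Ψ z - Ψ y) / (Φ z - Φ y) - d) (𝓝 y) (𝓝 0) := by
  set q : ℝ → ℝ := fun z => if Φ z = Φ y then 0 else (Ψ z - Ψ y) / (Φ z - Φ y) - d with hq
  have hqy : q y = 0 := by simp [hq]
  have hΦ' := hasDerivAt_iff_tendsto_slope.1 hΦ
  have hΨ' := hasDerivAt_iff_tendsto_slope.1 hΨ
  have hlim : Tendsto (fun z => slope Ψ y z / slope Φ y z - d) (𝓝[≠] y) (𝓝 (q y)) := by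
    have := (hΨ'.div hΦ' hσ).sub_const d
    rwa [mul_div_cancel_right₀ _ hσ, sub_self, ← hqy] at this
  rw [← hqy]
  refine continuousAt_iff_punctured_nhds.2 (hlim.congr' ?_)
  filter_upwards [hΦ'.eventually_ne hσ, self_mem_nhdsWithin] with z hz hzy
  have hzy' : z - y ≠ 0 := sub_ne_zero.2 hzy
  have hne : Φ z - Φ y ≠ 0 := fun h => hz (by simp [slope_def_field, h])
  simp only [hq, if_neg (sub_ne_zero.1 hne), slope_def_field]
  rw [div_div_div_cancel_right₀ hzy']

/-! ### The variation function, `D g`, `C g` and null points of `μ_g`. -/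

/-- The variation function dominates the increments of the function. -/
theorem abs_sub_le_varFun_sub {g : ℝ → ℝ} (hg : LocallyBoundedVariationOn g univ) {s t : ℝ}
    (hst : s ≤ t) : |g t - g s| ≤ varFun g t - varFun g s := by
  have h1 := variationOnFromTo.add hg (mem_univ 0) (mem_univ s) (mem_univ t)
  have h2 : varFun g t - varFun g s = variationOnFromTo g univ s t := by
    simp only [varFun]; linarith
  rw [h2, variationOnFromTo.eq_of_le _ _ hst, ← Real.dist_eq, ← ENNReal.ofReal_le_iff_le_toReal
    (hg s t (mem_univ _) (mem_univ _)), ← edist_dist]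
  exact eVariationOn.edist_le _ ⟨mem_univ _, hst, le_rfl⟩ ⟨mem_univ _, le_rfl, hst⟩

theorem monotone_varFun {g : ℝ → ℝ} (hg : LocallyBoundedVariationOn g univ) :
    Monotone (varFun g) := fun _ _ h =>
  sub_nonneg.1 ((abs_nonneg _).trans (abs_sub_le_varFun_sub hg h))

/-- A right jump of `g` is a jump of its variation function. -/
theorem mem_D_of_tendsto {g : ℝ → ℝ} (hg : LocallyBoundedVariationOn g univ) {t l : ℝ}
    (h : Tendsto g (𝓝[>] t) (𝓝 l)) (hl : l ≠ g t) : t ∈ D g := by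
  have hv := (monotone_varFun hg).tendsto_rightLim t
  have hle : |l - g t| ≤ Function.rightLim (varFun g) t - varFun g t := by
    refine le_of_tendsto_of_tendsto (h.sub_const _).abs (hv.sub_const _) ?_
    filter_upwards [self_mem_nhdsWithin] with s hs
    exact abs_sub_le_varFun_sub hg (le_of_lt hs)
  exact (abs_pos.2 (sub_ne_zero.2 hl)).trans_le hle

theorem eventually_eq_of_mem_C {g : ℝ → ℝ} (hg : LocallyBoundedVariationOn g univ) {t : ℝ}
    (ht : t ∈ C g) : ∀ᶠ s in 𝓝 t, g s = g t := by
  obtain ⟨ε, hε, h⟩ := ht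
  filter_upwards [Ioo_mem_nhds (sub_lt_self t hε) (lt_add_of_pos_right t hε)] with s hs
  have hvs := h s hs
  rcases le_total s t with hst | hst
  · have := abs_sub_le_varFun_sub hg hst
    rw [hvs, sub_self, abs_nonpos_iff] at this
    linarith
  · have := abs_sub_le_varFun_sub hg hst
    rw [hvs, sub_self, abs_nonpos_iff] at this
    linarith

theorem notMem_C_of_mem_D {g : ℝ → ℝ} {t : ℝ} (ht : t ∈ D g) : t ∉ C g := by
  rintro ⟨ε, hε, h⟩
  have : Function.rightLim (varFun g) t = varFun g t := by
    refine rightLim_eq_of_tendsto ?_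
    refine tendsto_const_nhds.congr' ?_
    filter_upwards [Ioo_mem_nhdsGT (lt_add_of_pos_right t hε)] with s hs
    exact (h s ⟨by linarith [hs.1], hs.2⟩).symm
  simp [D, jumpSet, this] at ht

theorem leftLim_clamp {g : ℝ → ℝ} (hc : ∀ t, ContinuousWithinAt g (Iic t) t) (a b x : ℝ) :
    Function.leftLim (clamp g a b) x = clamp g a b x :=
  leftLim_eq_of_tendsto ((continuousWithinAt_clamp hc a b x).mono Iio_subset_Iic_self)

theorem measure_Ico_eq_clamp {g : ℝ → ℝ} (hg : LocallyBoundedVariationOn g univ)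
    (hc : ∀ t, ContinuousWithinAt g (Iic t) t) (a b : ℝ) {s t : ℝ} (hst : s ≤ t) :
    measure g hg a b (Ico s t) = clamp g a b t - clamp g a b s := by
  rw [measure, BoundedVariationOn.vectorMeasure_Ico _ hst, leftLim_clamp hc, leftLim_clamp hc]

theorem clamp_of_mem {g : ℝ → ℝ} {a b x : ℝ} (hx : x ∈ Icc a b) : clamp g a b x = g x := by
  simp [clamp, hx.1, hx.2]

theorem eventually_clamp_eq_of_mem_C {g : ℝ → ℝ} (hg : LocallyBoundedVariationOn g univ)
    {a b t : ℝ} (htab : t ∈ Icc a b) (ht : t ∈ C g) :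
    ∀ᶠ s in 𝓝 t, clamp g a b s = clamp g a b t := by
  have hcont : Tendsto (fun x : ℝ => max a (min b x)) (𝓝 t) (𝓝 t) := by
    have h : Continuous fun x : ℝ => max a (min b x) := by fun_prop
    simpa [htab.1, htab.2] using h.tendsto t
  filter_upwards [hcont.eventually (eventually_eq_of_mem_C hg ht)] with s hs
  rw [clamp_of_mem htab]
  exact hs

/-- The point `b` carries no mass. -/
theorem measure_singleton_right {g : ℝ → ℝ} (hg : LocallyBoundedVariationOn g univ)
    (hc : ∀ t, ContinuousWithinAt g (Iic t) t) {a b : ℝ} :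
    measure g hg a b {b} = 0 := by
  have hr : Function.rightLim (clamp g a b) b = clamp g a b b := by
    refine rightLim_eq_of_tendsto (tendsto_const_nhds.congr' ?_)
    filter_upwards [self_mem_nhdsWithin] with s hs
    simp [clamp, le_of_lt (show b < s from hs)]
  rw [measure, BoundedVariationOn.vectorMeasure_singleton, hr, leftLim_clamp hc, sub_self]

/-- No cancellation can occur inside a point: its only subsets are itself and the empty set. -/
theorem totalVariation_singleton_eq_zero {X : Type*} [MeasurableSpace X] {μ : SignedMeasure X}
    {x : X} [MeasurableSingletonClass X] (hx : μ {x} = 0) : μ.totalVariation {x} = 0 := by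
  rw [SignedMeasure.totalVariation_eq_variation,
    VectorMeasure.variation_apply_eq_zero (measurableSet_singleton x)]
  intro t ht _
  rcases subset_singleton_iff_eq.1 ht with rfl | rfl
  · simp
  · exact hx

/-- If `V` is a distribution function of `ν`, `Φ ∘ V` is constant near `t` and `Φ` has nonzero
derivative at `V t`, then `t` is not in the support of `ν`. -/
theorem notMem_support_of_eventually_eq {ν : Measure ℝ} [IsFiniteMeasure ν] {Φ : ℝ → ℝ} {t σ : ℝ}
    (ht : ν {t} = 0) (hσ : σ ≠ 0) (hΦ : _root_.HasDerivAt Φ σ (ν.real (Iio t)))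
    (h : ∀ᶠ s in 𝓝 t, Φ (ν.real (Iio s)) = Φ (ν.real (Iio t))) : t ∉ ν.support := by
  -- A nonzero derivative keeps `Φ` from retaking its value near `V t`, and `V` is continuous at the
  -- non-atom `t`.
  have hV : ∀ᶠ s in 𝓝 t, ν.real (Iio s) = ν.real (Iio t) := by
    have h1 := eventually_nhdsWithin_iff.1 (hΦ.eventually_ne (c := Φ (ν.real (Iio t))) hσ)
    filter_upwards [h, (continuousAt_measureReal_Iio ht).eventually h1] with s hs hs'
    by_contra hne
    exact hs' hne hs
  obtain ⟨u, v, htuv, huv⟩ := mem_nhds_iff_exists_Ioo_subset.1 hV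
  obtain ⟨u', hu'⟩ := exists_between htuv.1
  obtain ⟨v', hv'⟩ := exists_between htuv.2
  rw [Measure.notMem_support_iff_exists]
  refine ⟨Ico u' v', Ico_mem_nhds hu'.2 hv'.1, ?_⟩
  have h1 : ν.real (Iio u') = ν.real (Iio t) := huv ⟨hu'.1, hu'.2.trans htuv.2⟩
  have h2 : ν.real (Iio v') = ν.real (Iio t) := huv ⟨htuv.1.trans hv'.1, hv'.2⟩
  have h3 : ν.real (Iio v' \ Iio u') = 0 := by
    rw [measureReal_sdiff (Iio_subset_Iio (hu'.2.trans hv'.1).le) measurableSet_Iio, h1, h2,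
      sub_self]
  rwa [Iio_sdiff_Iio, measureReal_eq_zero_iff] at h3

theorem setIntegral_Ico_eq_sub {ν : Measure ℝ} {k : ℝ → ℝ} (hk : Integrable k ν) {s t : ℝ}
    (hst : s ≤ t) :
    ∫ x in Ico s t, k x ∂ν = ∫ x in Iio t, k x ∂ν - ∫ x in Iio s, k x ∂ν := by
  rw [eq_sub_iff_add_eq', ← setIntegral_union ?_ measurableSet_Ico hk.integrableOn hk.integrableOn,
    Iio_union_Ico_eq_Iio hst]
  exact disjoint_left.2 fun x (hx : x < s) hx' => hx.not_ge hx'.1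

theorem setIntegral_Iic_sub_Iio {ν : Measure ℝ} {k : ℝ → ℝ} (hk : Integrable k ν) (t : ℝ) :
    ∫ x in Iic t, k x ∂ν - ∫ x in Iio t, k x ∂ν = ν.real {t} * k t := by
  rw [← Iio_union_right, setIntegral_union (by simp) (measurableSet_singleton t) hk.integrableOn
    hk.integrableOn, integral_singleton]
  simp

/-! ### Differentiation of the primitive. -/

/-- The primitive of an integrable function is differentiable almost everywhere, with derivative
the function. -/
theorem ae_hasDerivAt_primitive {g : ℝ → ℝ} (hg : LocallyBoundedVariationOn g univ)
    (hleft : ∀ t, ContinuousWithinAt g (Iic t) t) {a b : ℝ} {f : ℝ → ℝ} (hf : MemL1 g hg a b f) :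
    ∀ᵐ t ∂(measure g hg a b).totalVariation, t ∈ Icc a b →
      HasDerivAt g a b (primitive g hg a b f) (f t) t := by
  set μ := Stieltjes.measure g hg a b with hμ
  set ν := μ.totalVariation with hν
  obtain ⟨σ, hσm, hσ1, hσ⟩ := exists_sign_density μ
  have hσ0 : ∀ x, σ x ≠ 0 := fun x => abs_pos.1 (by rw [hσ1]; exact one_pos)
  have hσi : Integrable σ ν :=
    Integrable.of_bound hσm.aestronglyMeasurable 1 (.of_forall fun x => (hσ1 x).le)
  -- `f` is integrable only on `[a,b)`, hence the cut-off; `b` itself is `ν`-null.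
  set k : ℝ → ℝ := fun x => (Ico a b).indicator f x * σ x with hk
  have hki : Integrable k ν :=
    (hf.integrable_indicator measurableSet_Ico).mul_bdd (c := 1) hσm.aestronglyMeasurable
      (.of_forall fun x => (hσ1 x).le)
  obtain ⟨Φ, hΦ, hΦd⟩ := exists_hasDerivAt_setIntegral_Iio hσi
  obtain ⟨Ψ, hΨ, hΨd⟩ := exists_hasDerivAt_setIntegral_Iio hki
  have hG_le : ∀ s t, s ≤ t → clamp g a b t - clamp g a b s =
      ∫ x in Iio t, σ x ∂ν - ∫ x in Iio s, σ x ∂ν := by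
    intro s t hst
    rw [← measure_Ico_eq_clamp hg hleft a b hst, ← setIntegral_Ico_eq_sub hσi hst]
    have h := hσ (Ico s t) measurableSet_Ico (fun _ => 1) (integrable_const _).integrableOn
    have : IsFiniteMeasure μ.variation := by
      rw [← SignedMeasure.totalVariation_eq_variation]
      infer_instance
    rw [VectorMeasure.integral_const] at h
    simpa [VectorMeasure.restrict_apply _ measurableSet_Ico MeasurableSet.univ] using h
  have hG : ∀ s t, clamp g a b t - clamp g a b s =
      ∫ x in Iio t, σ x ∂ν - ∫ x in Iio s, σ x ∂ν := by
    intro s t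
    rcases le_total s t with h | h
    · exact hG_le s t h
    · linarith [hG_le t s h]
  have hF : ∀ s ∈ Icc a b, primitive g hg a b f s =
      ∫ x in Iio s, k x ∂ν - ∫ x in Iio a, k x ∂ν := by
    intro s hs
    have hsub : Ico a s ⊆ Ico a b := Ico_subset_Ico_right hs.2
    rw [← setIntegral_Ico_eq_sub hki hs.1, primitive, hσ _ measurableSet_Ico f (hf.mono_set hsub)]
    refine setIntegral_congr_fun measurableSet_Ico fun x hx => ?_
    simp [hk, indicator_of_mem (hsub hx)]
  have hνb : ν {b} = 0 := totalVariation_singleton_eq_zero (measure_singleton_right hg hleft)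
  filter_upwards [hΦd, hΨd, ν.support_mem_ae, measure_eq_zero_iff_ae_notMem.1 hνb]
    with t hΦt hΨt hsupp htb htab
  have htI : t ∈ Ico a b := ⟨htab.1, lt_of_le_of_ne htab.2 htb⟩
  have hkt : k t = f t * σ t := by simp [hk, indicator_of_mem htI]
  set F := primitive g hg a b f
  -- The value `0` where `g s = g t` is harmless for the identity and keeps `h` continuous.
  set h : ℝ → ℝ := fun s => if g s = g t then 0 else (F s - F t) / (g s - g t) - f t with hh
  have hgs : ∀ s ∈ Icc a b, g s - g t = ∫ x in Iio s, σ x ∂ν - ∫ x in Iio t, σ x ∂ν := by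
    intro s hs
    rw [← hG t s, clamp_of_mem hs, clamp_of_mem htab]
  have hFs : ∀ s ∈ Icc a b, F s - F t = ∫ x in Iio s, k x ∂ν - ∫ x in Iio t, k x ∂ν := by
    intro s hs
    rw [hF s hs, hF t htab]
    ring
  have hht : h t = 0 := by simp [hh]
  have heq : ∀ s ∈ Icc a b, g s ≠ g t → F s = F t + (f t + h s) * (g s - g t) := by
    intro s _ hs
    have : g s - g t ≠ 0 := sub_ne_zero.2 hs
    simp only [hh, if_neg hs]
    field_simp
    ring
  by_cases h0 : ν {t} = 0
  · have hd := hΨt h0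
    rw [hkt] at hd
    have htC : t ∉ C g := by
      intro htC
      refine notMem_support_of_eventually_eq h0 (hσ0 t) (hΦt h0) ?_ hsupp
      filter_upwards [eventually_clamp_eq_of_mem_C hg htab htC] with s hs
      have := hG t s
      rw [hs, sub_self, hΦ, hΦ] at this
      linarith
    have hst : Stieltjes.star g t = t := if_neg htC
    have hcont : ContinuousWithinAt h (Icc a b) t := by
      have hr := (tendsto_ratio_sub (hΦt h0) hd (hσ0 t)).comp
        (continuousAt_measureReal_Iio h0).tendsto
      rw [ContinuousWithinAt, hht]
      refine (hr.mono_left nhdsWithin_le_nhds).congr' ?_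
      filter_upwards [self_mem_nhdsWithin] with s hs
      simp only [Function.comp, hh, hFs s hs, hgs s hs, ← hΦ, ← hΨ]
      simp only [← sub_eq_zero (b := g t), hgs s hs]
      simp only [sub_eq_zero]
    refine ⟨h, ?_⟩
    rw [hst]
    -- Two-sided continuity covers every case, so whether `t ∈ N g` is irrelevant.
    exact ⟨hht, fun _ => hcont, fun _ => hcont.mono inter_subset_left,
      fun _ => hcont.mono inter_subset_left, heq⟩
  · have hpos : ν.real {t} ≠ 0 := by
      rwa [Ne, measureReal_eq_zero_iff]
    have hmem : Icc a b ∈ 𝓝[>] t :=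
      mem_of_superset (Ioo_mem_nhdsGT htI.2) fun s hs => ⟨htab.1.trans hs.1.le, hs.2.le⟩
    have hgl : Tendsto (fun s => g s - g t) (𝓝[>] t) (𝓝 (ν.real {t} * σ t)) := by
      rw [← setIntegral_Iic_sub_Iio hσi t]
      refine ((tendsto_setIntegral_Iio_nhdsGT hσi t).sub_const _).congr' ?_
      filter_upwards [hmem] with s hs using (hgs s hs).symm
    have hFl : Tendsto (fun s => F s - F t) (𝓝[>] t) (𝓝 (ν.real {t} * k t)) := by
      rw [← setIntegral_Iic_sub_Iio hki t]
      refine ((tendsto_setIntegral_Iio_nhdsGT hki t).sub_const _).congr' ?_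
      filter_upwards [hmem] with s hs using (hFs s hs).symm
    have hne : ν.real {t} * σ t ≠ 0 := mul_ne_zero hpos (hσ0 t)
    have htD : t ∈ D g := by
      refine mem_D_of_tendsto hg (l := ν.real {t} * σ t + g t)
        ((hgl.add_const (g t)).congr fun s => by ring) (by simpa using hne)
    have hst : Stieltjes.star g t = t := if_neg (notMem_C_of_mem_D htD)
    have hcont : ContinuousWithinAt h (Ici t) t := by
      rw [← continuousWithinAt_Ioi_iff_Ici, ContinuousWithinAt, hht]
      have hl := (hFl.div hgl hne).sub_const (f t)
      have hz : ν.real {t} * k t / (ν.real {t} * σ t) - f t = 0 := by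
        rw [hkt]
        field_simp [hpos, hσ0 t]
        ring
      rw [hz] at hl
      refine hl.congr' ?_
      filter_upwards [hgl.eventually_ne hne] with s hs
      simp [hh, if_neg (sub_ne_zero.1 hs)]
    refine ⟨h, ?_⟩
    rw [hst]
    -- `t ∈ D g` excludes the two-sided case, and also `Nminus g`, which omits the jumps.
    exact ⟨hht, fun ht => absurd (Or.inl (Or.inr htD)) ht.2,
      fun _ => hcont.mono inter_subset_right, fun ht => absurd htD ht.2.2, heq⟩

end Stieltjes

theorem mainTheorem1 (g : ℝ → ℝ) (hg : LocallyBoundedVariationOn g Set.univ)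
    (hleft : ∀ t, ContinuousWithinAt g (Set.Iic t) t)
    (a b : ℝ) (hab : a < b)
    (ha : a ∉ Stieltjes.Nminus g)
    (hb : b ∉ Stieltjes.C g ∪ Stieltjes.Nplus g ∪ Stieltjes.D g)
    (hga : g a = 0)
    (f : ℝ → ℝ) (hf : Stieltjes.MemL1 g hg a b f) :
    ∀ᵐ t ∂(Stieltjes.measure g hg a b).totalVariation, t ∈ Set.Icc a b →
      Stieltjes.HasDerivAt g a b (Stieltjes.primitive g hg a b f) (f t) t := by
  exact Stieltjes.ae_hasDerivAt_primitive hg hleft hf
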